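/- Consider diagrams of oriented links in $S^3$. A *pass-move* on a diagram changes all four crossings at a place where two anti-parallel strands pass over (or under) two other anti-parallel strands. A *1-2-move* changes all four crossings at a place where two parallel strands pass over (or under) two anti-parallel strands. For an oriented link $L$ let $p(L)$ (respectively $nt(L)$) be the minimal number of pass-moves (respectively 1-2-moves), each performed on an arbitrary diagram of the link at hand, with isotopies allowed before, between and after the moves, that change $L$ to an unknot or an unlink; the number is $\infty$ if there is no such sequence. Let $L$ be the untwisted 2-cable of the Hopf link in which the two cables of each pair are oppositely oriented. That is, each component of the Hopf link is replaced by two parallel copies of itself, with linking number $0$, which are given opposite orientations. Then $$p(L) = 1 \qquad\text{and}\qquad nt(L) = 2 .$$ -/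

import Mathlib

/-!
Oriented link diagrams in the plane, in general position with respect to the height function,
cut into elementary horizontal layers and read from bottom to top. Each layer contains exactly one
minimum, maximum or crossing, besides vertical strands to its left and to its right.
A horizontal level is recorded by the list, from left to right, of the directions of the strands
that cross it: `true` for a strand that is oriented upwards, `false` for downwards.
-/

namespace OneTwoPass

/-- Elementary pieces of an oriented diagram.
* `cup o` is a local minimum whose left end has direction `o` (and whose right end has `!o`);
* `cap o` is a local maximum whose left end has direction `o` (and whose right end has `!o`);
* `cross σ a b` is a crossing of a strand from bottom left to top right, of direction `a`, with a
  strand from bottom right to top left, of direction `b`; the strand from bottom left to top right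
  is the over-strand if `σ = true` and the under-strand if `σ = false`. -/
inductive Piece
  | cup (o : Bool)
  | cap (o : Bool)
  | cross (σ a b : Bool)

open Piece

/-- Directions of the strands at the bottom of a piece. -/
def Piece.bot : Piece → List Bool
  | cup _ => []
  | cap o => [o, !o]
  | cross _ a b => [a, b]

/-- Directions of the strands at the top of a piece. -/
def Piece.top : Piece → List Bool
  | cup o => [o, !o]
  | cap _ => []
  | cross _ a b => [b, a]

/-- A layer: one piece, with vertical strands to its left and to its right. -/
structure Layer where
  left : List Bool
  piece : Piece
  right : List Bool

def Layer.bot (x : Layer) : List Bool := x.left ++ x.piece.bot ++ x.right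

def Layer.top (x : Layer) : List Bool := x.left ++ x.piece.top ++ x.right

/-- A stack of layers, listed from bottom to top. -/
abbrev Word := List Layer

/-- The layers of the word fit together to an oriented tangle diagram from level `s` (bottom) to
level `t` (top). -/
def IsTangle : Word → List Bool → List Bool → Prop
  | [], s, t => s = t
  | x :: w, s, t => s = x.bot ∧ IsTangle w x.top t

/-- Add vertical strands `l` to the left and `r` to the right of all layers of a word. -/
def pad (l r : List Bool) (w : Word) : Word :=
  w.map fun x => ⟨l ++ x.left, x.piece, x.right ++ r⟩

/-- An oriented link diagram: a tangle diagram without end points. -/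
structure LinkDiagram where
  word : Word
  closed : IsTangle word [] []

/-- `D'` arises from `D` by replacing one subdiagram `w` with `w'`, where `R w w'`. -/
def Replaces (R : Word → Word → Prop) (D D' : LinkDiagram) : Prop :=
  ∃ (u v w w' : Word) (l r : List Bool), R w w' ∧
    D.word = u ++ pad l r w ++ v ∧ D'.word = u ++ pad l r w' ++ v

/-- The elementary moves that generate isotopy of oriented links: planar isotopy (`exchange`,
`zigzag`, `zigzag'`, `swingCap`, `swingCup`) and the Reidemeister moves. The empty word stands for
vertical strands only. -/
inductive IsotopyMove : Word → Word → Prop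
  /-- Pieces that lie side by side can exchange their heights. -/
  | exchange (p q : Piece) (m : List Bool) :
      IsotopyMove
        [⟨[], p, m ++ q.bot⟩, ⟨p.top ++ m, q, []⟩]
        [⟨p.bot ++ m, q, []⟩, ⟨[], p, m ++ q.top⟩]
  /-- A minimum and a maximum that are adjacent along a strand cancel. -/
  | zigzag (s : Bool) :
      IsotopyMove [⟨[s], cup (!s), []⟩, ⟨[], cap s, [s]⟩] []
  | zigzag' (s : Bool) :
      IsotopyMove [⟨[], cup s, [s]⟩, ⟨[s], cap (!s), []⟩] []
  /-- A crossing is turned around a maximum. -/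
  | swingCap (σ o s : Bool) :
      IsotopyMove
        [⟨[], cross σ o s, [!o]⟩, ⟨[s], cap o, []⟩]
        [⟨[o], cross (!σ) s (!o), []⟩, ⟨[], cap o, [s]⟩]
  /-- A crossing is turned around a minimum. -/
  | swingCup (σ o s : Bool) :
      IsotopyMove
        [⟨[s], cup o, []⟩, ⟨[], cross σ s o, [!o]⟩]
        [⟨[], cup o, [s]⟩, ⟨[o], cross (!σ) (!o) s, []⟩]
  /-- First Reidemeister move, kink to the right. -/
  | reidemeister₁ (σ s : Bool) :
      IsotopyMove [⟨[s], cup s, []⟩, ⟨[], cross σ s s, [!s]⟩, ⟨[s], cap s, []⟩] []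
  /-- First Reidemeister move, kink to the left. -/
  | reidemeister₁' (σ s : Bool) :
      IsotopyMove [⟨[], cup (!s), [s]⟩, ⟨[!s], cross σ s s, []⟩, ⟨[], cap (!s), [s]⟩] []
  /-- Second Reidemeister move. -/
  | reidemeister₂ (σ s t : Bool) :
      IsotopyMove [⟨[], cross σ s t, []⟩, ⟨[], cross (!σ) t s, []⟩] []
  /-- Third Reidemeister move for strands `a`, `b`, `c`. Here `σ`, `τ`, `υ` say that `a` is over
  `b`, that `a` is over `c`, and that `b` is over `c`; the hypothesis says that one of the strands
  is above the two others, and one is below the two others. -/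
  | reidemeister₃ (σ τ υ a b c : Bool) (h : τ = σ ∨ τ = υ) :
      IsotopyMove
        [⟨[], cross σ a b, [c]⟩, ⟨[b], cross τ a c, []⟩, ⟨[], cross υ b c, [a]⟩]
        [⟨[a], cross υ b c, []⟩, ⟨[], cross τ a c, [b]⟩, ⟨[c], cross σ a b, []⟩]

/-- Oriented links up to isotopy: oriented diagrams modulo the equivalence relation generated by
planar isotopy and the Reidemeister moves. -/
def Link := Quot (Replaces IsotopyMove)

/-- The link represented by a diagram. -/
def LinkDiagram.link (D : LinkDiagram) : Link := Quot.mk _ D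

/-- Two strands of directions `a`, `a'` that run next to each other from bottom left to top right
cross two strands of directions `b`, `b'` that run next to each other from bottom right to top
left. The first two strands are over the other two at all four crossings if `σ = true`, and under
them if `σ = false`. -/
def grid (σ a a' b b' : Bool) : Word :=
  [⟨[a], cross σ a' b, [b']⟩, ⟨[], cross σ a b, [a', b']⟩,
    ⟨[b, a], cross σ a' b', []⟩, ⟨[b], cross σ a b', [a']⟩]

/-- The local pictures of the pass-move: two anti-parallel strands are over or under two other
anti-parallel strands, and all four crossings are changed. -/
inductive PassPicture : Word → Word → Prop
  | mk (σ a b : Bool) : PassPicture (grid σ a (!a) b (!b)) (grid (!σ) a (!a) b (!b))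

/-- The local pictures of the 1-2-move: two parallel strands are over or under two anti-parallel
strands, and all four crossings are changed. -/
inductive OneTwoPicture : Word → Word → Prop
  | parallelLeft (σ a b : Bool) : OneTwoPicture (grid σ a a b (!b)) (grid (!σ) a a b (!b))
  | parallelRight (σ a b : Bool) : OneTwoPicture (grid σ a (!a) b b) (grid (!σ) a (!a) b b)

/-- `L'` arises from `L` by a single local move with pictures `P`, performed on some diagram. -/
def MoveBetween (P : Word → Word → Prop) (L L' : Link) : Prop :=
  ∃ D D' : LinkDiagram, D.link = L ∧ D'.link = L' ∧ Replaces P D D'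

/-- Disjoint circles without crossings, stacked on top of each other; the list gives their
orientations. -/
def circles (os : List Bool) : Word :=
  os.flatMap fun o => [⟨[], cup o, []⟩, ⟨[], cap o, []⟩]

/-- An unlink (an unknot, if it has one component). -/
def IsUnlink (L : Link) : Prop :=
  ∃ (D : LinkDiagram) (os : List Bool), D.word = circles os ∧ D.link = L

/-- `L` can be changed to an unlink by `n` local moves with pictures `P`, with isotopies in
between. -/
def UnlinksIn (P : Word → Word → Prop) : ℕ → Link → Prop
  | 0, L => IsUnlink L
  | n + 1, L => ∃ L', MoveBetween P L L' ∧ UnlinksIn P n L'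

/-- The minimal number of local moves with pictures `P` that change `L` to an unlink (`⊤` if this
is impossible). -/
noncomputable def moveNumber (P : Word → Word → Prop) (L : Link) : ℕ∞ :=
  ⨅ (n : ℕ) (_ : UnlinksIn P n L), (n : ℕ∞)

/-- The pass-move number `p(L)`. -/
noncomputable def passNumber (L : Link) : ℕ∞ := moveNumber PassPicture L

/-- The 1-2-move number `nt(L)`. -/
noncomputable def oneTwoNumber (L : Link) : ℕ∞ := moveNumber OneTwoPicture L

/-- Each vertical strand is replaced by two, the left one going up and the right one down. -/
def cableLevel (s : List Bool) : List Bool := s.flatMap fun _ => [true, false]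

/-- The anti-parallel 2-cable of a piece (it does not depend on the orientation of the piece). -/
def cablePiece : Piece → Word
  | cup _ => [⟨[], cup true, []⟩, ⟨[true], cup false, [false]⟩]
  | cap _ => [⟨[true], cap false, [false]⟩, ⟨[], cap true, []⟩]
  | cross σ _ _ => grid σ true false true false

def cableWord (w : Word) : Word :=
  w.flatMap fun x => pad (cableLevel x.left) (cableLevel x.right) (cablePiece x.piece)

theorem IsTangle.append {w w' : Word} {s t u : List Bool} (h : IsTangle w s t)
    (h' : IsTangle w' t u) : IsTangle (w ++ w') s u := by
  induction w generalizing s with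
  | nil => cases h; exact h'
  | cons x w ih => exact ⟨h.1, ih h.2⟩

theorem isTangle_cableWord {w : Word} {s t : List Bool} (h : IsTangle w s t) :
    IsTangle (cableWord w) (cableLevel s) (cableLevel t) := by
  induction w generalizing s with
  | nil => cases h; rfl
  | cons x w ih =>
    obtain ⟨rfl, h⟩ := h
    refine IsTangle.append (t := cableLevel x.top) ?_ (ih h)
    obtain ⟨l, p, r⟩ := x
    cases p <;>
      simp [cablePiece, pad, grid, IsTangle, Layer.bot, Layer.top, Piece.bot, Piece.top,
        cableLevel]

/-- The anti-parallel 2-cable of a diagram: each component is replaced by the two boundary curves,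
with opposite orientations, of a thin annulus in the plane of the diagram along the component. If no
component crosses itself, then the two curves have linking number 0: the cable is untwisted. -/
def LinkDiagram.antiparallelCable (D : LinkDiagram) : LinkDiagram :=
  ⟨cableWord D.word, isTangle_cableWord D.closed⟩

/-- The standard diagram of the Hopf link: two circles that cross each other twice. -/
def hopf : LinkDiagram where
  word :=
    [⟨[], cup true, []⟩, ⟨[true, false], cup true, []⟩,
      ⟨[true], cross true false true, [false]⟩, ⟨[true], cross true true false, [false]⟩,
      ⟨[true, false], cap true, []⟩, ⟨[], cap true, []⟩]
  closed := by
    simp [IsTangle, Layer.bot, Layer.top, Piece.bot, Piece.top]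

/-- The untwisted 2-cable of the Hopf link, where the two cables of each pair have opposite
orientations. -/
def hopfCable : Link := hopf.antiparallelCable.link

end OneTwoPass

/-! The lower bounds come from linking numbers, the upper bounds from explicit isotopies. Color the
components and add up, over all crossings, the sign times `g` of the two colors. If `g` is symmetric
and vanishes on the diagonal, this is twice the sum of `lk * g` over pairs of components, so the set
of values (`Link.weights`) is a link invariant, and an unlink has only the value 0. For `g x y = (x
- y) ^ 4` and four distinct colors, the cable attains `2 * (81 + 1 - 16 - 16) = 100`, so it is not
an unlink. Changing the crossings of a grid reverses the sign of its contribution. If an unlink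
results, that contribution was half of the weight (`weight_eq_of_grid`), here 50. In a 1-2-picture
the two parallel strands contribute with equal signs, and then 50 is impossible
(`fourthPower_grid_ne`). Conversely, the cable bounds two annuli that meet in two grids. A pass-move
at one grid puts one annulus above the other, and they come apart (`isUnlink_annuli_false`). Folding
one strand of an annulus turns this grid into two grids with parallel strands
(`link_annuli_eq_link_detour`), so two 1-2-moves do the work of the pass-move. -/

namespace OneTwoPass

open Piece

/-! ### Colorings of the components, and linking numbers -/

section Coloring

variable {C : Type*} (g : C → C → ℤ)

/-- The sign of a direction. -/
def dirSign (b : Bool) : ℤ := if b then 1 else -1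

theorem dirSign_not (b : Bool) : dirSign (!b) = -dirSign b := by
  cases b <;> rfl

/-- A piece is colored so that colors are constant along strands. The weight of a crossing is its
sign times the value of `g` at the colors of its strands. -/
def PieceColoring : Piece → List C → List C → ℤ → Prop
  | cup _, S, T, n => S = [] ∧ (∃ c, T = [c, c]) ∧ n = 0
  | cap _, S, T, n => (∃ c, S = [c, c]) ∧ T = [] ∧ n = 0
  | cross σ a b, S, T, n =>
      ∃ x y, S = [x, y] ∧ T = [y, x] ∧ n = dirSign σ * dirSign a * dirSign b * g x y

/-- A coloring of a layer with bottom colors `S`, top colors `T` and weight `n`. -/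
def LayerColoring (x : Layer) (S T : List C) (n : ℤ) : Prop :=
  ∃ cl cr s t, cl.length = x.left.length ∧ cr.length = x.right.length ∧ S = cl ++ s ++ cr ∧
    T = cl ++ t ++ cr ∧ PieceColoring g x.piece s t n

/-- A coloring of a word with bottom colors `S`, top colors `T` and total weight `n`. -/
def WordColoring : Word → List C → List C → ℤ → Prop
  | [], S, T, n => S = T ∧ n = 0
  | x :: w, S, T, n => ∃ M k m, LayerColoring g x S M k ∧ WordColoring w M T m ∧ n = k + m

variable {g}

theorem PieceColoring.length {p : Piece} {s t : List C} {n : ℤ} (h : PieceColoring g p s t n) :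
    s.length = p.bot.length ∧ t.length = p.top.length := by
  cases p
  · obtain ⟨rfl, ⟨c, rfl⟩, -⟩ := h; exact ⟨rfl, rfl⟩
  · obtain ⟨⟨c, rfl⟩, rfl, -⟩ := h; exact ⟨rfl, rfl⟩
  · obtain ⟨x, y, rfl, rfl, -⟩ := h; exact ⟨rfl, rfl⟩

theorem LayerColoring.length {x : Layer} {S T : List C} {n : ℤ} (h : LayerColoring g x S T n) :
    S.length = x.bot.length ∧ T.length = x.top.length := by
  obtain ⟨cl, cr, s, t, hl, hr, rfl, rfl, hp⟩ := h
  simp [Layer.bot, Layer.top, hl, hr, hp.length.1, hp.length.2]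

theorem WordColoring.length {w : Word} {s t : List Bool} (hw : IsTangle w s t) {S T : List C}
    {n : ℤ} (hS : S.length = s.length) (h : WordColoring g w S T n) : T.length = t.length := by
  induction w generalizing s S n with
  | nil => cases hw; rw [← h.1, hS]
  | cons x w ih =>
    obtain ⟨M, k, m, h₁, h₂, -⟩ := h
    exact ih hw.2 h₁.length.2 h₂

theorem wordColoring_append {w w' : Word} {S T : List C} {n : ℤ} :
    WordColoring g (w ++ w') S T n ↔
      ∃ M k m, WordColoring g w S M k ∧ WordColoring g w' M T m ∧ n = k + m := by
  induction w generalizing S n with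
  | nil =>
    constructor
    · intro h
      exact ⟨S, 0, n, ⟨rfl, rfl⟩, h, by simp⟩
    · rintro ⟨M, k, m, ⟨rfl, rfl⟩, h, rfl⟩
      simpa using h
  | cons x w ih =>
    constructor
    · rintro ⟨M, k, m, h₁, h₂, rfl⟩
      obtain ⟨M', k', m', h₃, h₄, rfl⟩ := ih.1 h₂
      exact ⟨M', k + k', m', ⟨M, k, k', h₁, h₃, rfl⟩, h₄, by ring⟩
    · rintro ⟨M', k', m', ⟨M, k, m, h₁, h₂, rfl⟩, h₃, rfl⟩
      exact ⟨M, k, m + m', h₁, ih.2 ⟨M', m, m', h₂, h₃, rfl⟩, by ring⟩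

theorem WordColoring.pad {w : Word} {S T : List C} {n : ℤ} (h : WordColoring g w S T n)
    {l r : List Bool} {cl cr : List C} (hl : cl.length = l.length) (hr : cr.length = r.length) :
    WordColoring g (pad l r w) (cl ++ S ++ cr) (cl ++ T ++ cr) n := by
  induction w generalizing S n with
  | nil => exact ⟨by rw [h.1], h.2⟩
  | cons x w ih =>
    obtain ⟨M, k, m, ⟨dl, dr, s, t, hdl, hdr, rfl, rfl, hp⟩, h₂, rfl⟩ := h
    exact ⟨_, k, m, ⟨cl ++ dl, dr ++ cr, s, t, by simp [hl, hdl], by simp [hr, hdr], by simp, rfl,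
      hp⟩, by simpa [OneTwoPass.pad] using ih h₂, rfl⟩

/-- Padding strands run vertically through every layer, so their colors persist; the tangle
structure fixes the lengths at which the color lists must be split. -/
theorem WordColoring.of_pad {w : Word} {l r : List Bool} {cl cr S T : List C} {n : ℤ}
    {s t : List Bool} (hw : IsTangle w s t) (hl : cl.length = l.length)
    (hr : cr.length = r.length) (hS : S.length = s.length)
    (h : WordColoring g (OneTwoPass.pad l r w) (cl ++ S ++ cr) T n) :
    ∃ T', T = cl ++ T' ++ cr ∧ WordColoring g w S T' n := by
  induction w generalizing s S n with
  | nil => exact ⟨S, h.1.symm, rfl, h.2⟩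
  | cons x w ih =>
    obtain ⟨M, k, m, ⟨dl, dr, s', t', hdl, hdr, hS', rfl, hp⟩, h₂, rfl⟩ := h
    obtain ⟨rfl, hw⟩ := hw
    simp only [List.length_append] at hdl hdr
    obtain ⟨cl', el, rfl, hcl'⟩ : ∃ a b, dl = a ++ b ∧ a.length = l.length :=
      ⟨dl.take l.length, dl.drop l.length, by simp, by simp; lia⟩
    obtain ⟨er, cr', rfl, hcr'⟩ : ∃ a b, dr = a ++ b ∧ b.length = r.length :=
      ⟨dr.take x.right.length, dr.drop x.right.length, by simp, by simp; lia⟩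
    have e₁ : cl' = cl ∧ el ++ s' ++ er ++ cr' = S ++ cr := by
      have h' : cl ++ (S ++ cr) = cl' ++ (el ++ s' ++ er ++ cr') := by simpa using hS'
      have := List.append_inj h' (by lia)
      exact ⟨this.1.symm, this.2.symm⟩
    obtain ⟨rfl, e₁⟩ := e₁
    obtain ⟨rfl, rfl⟩ := List.append_inj' e₁ (by lia)
    simp only [List.length_append] at hdl hdr
    have hx : LayerColoring g x (el ++ s' ++ er) (el ++ t' ++ er) k :=
      ⟨el, er, s', t', by lia, by lia, rfl, rfl, hp⟩
    obtain ⟨T', rfl, h₃⟩ := ih (S := el ++ t' ++ er) hw hx.length.2 (by simpa [OneTwoPass.pad] using h₂)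
    exact ⟨T', rfl, _, k, m, hx, h₃, rfl⟩

/-- Both sides of a local move are tangles with the same ends, and the colorings of the ends
that extend, with a given weight, to one side are those that extend to the other side. -/
def ColoringEquiv (g : C → C → ℤ) (w w' : Word) : Prop :=
  ∃ s t, IsTangle w s t ∧ IsTangle w' s t ∧ ∀ S T n, S.length = s.length →
    (WordColoring g w S T n ↔ WordColoring g w' S T n)

/-! ### Restricting colorings to subdiagrams and gluing them. -/

theorem IsTangle.pad {w : Word} {s t : List Bool} (h : IsTangle w s t) (l r : List Bool) :
    IsTangle (pad l r w) (l ++ s ++ r) (l ++ t ++ r) := by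
  induction w generalizing s with
  | nil => cases h; rfl
  | cons x w ih =>
    obtain ⟨rfl, h⟩ := h
    exact ⟨by simp [Layer.bot], by simpa [Layer.top, OneTwoPass.pad] using ih h⟩

theorem IsTangle.bot_unique {w : Word} (hw : w ≠ []) {s s' t t' : List Bool}
    (h : IsTangle w s t) (h' : IsTangle w s' t') : s = s' := by
  cases w with
  | nil => exact absurd rfl hw
  | cons x w => exact h.1.trans h'.1.symm

theorem isTangle_append {w w' : Word} {s t : List Bool} :
    IsTangle (w ++ w') s t ↔ ∃ m, IsTangle w s m ∧ IsTangle w' m t := by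
  constructor
  · intro h
    induction w generalizing s with
    | nil => exact ⟨s, rfl, h⟩
    | cons x w ih =>
      obtain ⟨m, h₁, h₂⟩ := ih h.2
      exact ⟨m, ⟨h.1, h₁⟩, h₂⟩
  · rintro ⟨m, h₁, h₂⟩
    exact h₁.append h₂

/-- The strands below a nonempty subdiagram of a closed diagram. -/
theorem isTangle_below {u v w : Word} {l r s t : List Bool} (hw : IsTangle w s t) (hne : w ≠ [])
    (hD : IsTangle (u ++ pad l r w ++ v) [] []) : IsTangle u [] (l ++ s ++ r) := by
  obtain ⟨m, hu, -⟩ := isTangle_append.1 hD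
  obtain ⟨m', hu, hm⟩ := isTangle_append.1 hu
  rwa [← IsTangle.bot_unique (by simpa [OneTwoPass.pad] using hne) hm (hw.pad l r)]

/-- A coloring of a closed diagram restricts to a subdiagram. -/
theorem WordColoring.split {u v w : Word} {l r s t : List Bool} (hw : IsTangle w s t)
    (hu : IsTangle u [] (l ++ s ++ r)) {n : ℤ}
    (h : WordColoring g (u ++ OneTwoPass.pad l r w ++ v) [] [] n) :
    ∃ cl cr S T a b c, cl.length = l.length ∧ cr.length = r.length ∧ S.length = s.length ∧
      WordColoring g u [] (cl ++ S ++ cr) a ∧ WordColoring g w S T b ∧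
      WordColoring g v (cl ++ T ++ cr) [] c ∧ n = a + b + c := by
  obtain ⟨M, k, c, h₀, h₃, rfl⟩ := wordColoring_append.1 h
  obtain ⟨M', a, b, h₁, h₂, rfl⟩ := wordColoring_append.1 h₀
  have hM := WordColoring.length (S := ([] : List C)) hu rfl h₁
  simp only [List.length_append] at hM
  obtain ⟨cl, S, cr, rfl, hcl, hS, hcr⟩ : ∃ cl S cr, M' = cl ++ S ++ cr ∧
      cl.length = l.length ∧ S.length = s.length ∧ cr.length = r.length :=
    ⟨M'.take l.length, (M'.drop l.length).take s.length, (M'.drop l.length).drop s.length,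
      by rw [List.append_assoc, List.take_append_drop, List.take_append_drop],
      by simp; lia, by simp; lia, by simp; lia⟩
  obtain ⟨T, rfl, h₄⟩ := WordColoring.of_pad hw hcl hcr hS h₂
  exact ⟨cl, cr, S, T, a, b, c, hcl, hcr, hS, h₁, h₄, h₃, rfl⟩

theorem WordColoring.join {u v w : Word} {l r : List Bool} {cl cr S T : List C} {a b c : ℤ}
    (hl : cl.length = l.length) (hr : cr.length = r.length)
    (hu : WordColoring g u [] (cl ++ S ++ cr) a) (hw : WordColoring g w S T b)
    (hv : WordColoring g v (cl ++ T ++ cr) [] c) :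
    WordColoring g (u ++ OneTwoPass.pad l r w ++ v) [] [] (a + b + c) :=
  wordColoring_append.2 ⟨_, _, _, wordColoring_append.2 ⟨_, _, _, hu, hw.pad hl hr, rfl⟩, hv, rfl⟩

/-- A coloring is cut at the ends of the subdiagram and reglued. An empty `w` would fit at any
level, so nonemptiness is what determines the strands below. -/
theorem ColoringEquiv.closed_iff {w w' u v : Word} {l r : List Bool} (h : ColoringEquiv g w w')
    (hne : w ≠ []) (hD : IsTangle (u ++ pad l r w ++ v) [] []) (n : ℤ) :
    WordColoring g (u ++ pad l r w ++ v) [] [] n ↔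
      WordColoring g (u ++ pad l r w' ++ v) [] [] n := by
  obtain ⟨s, t, hw, hw', h⟩ := h
  have hu := isTangle_below hw hne hD
  constructor <;> intro hc
  · obtain ⟨cl, cr, S, T, a, b, c, hcl, hcr, hS, h₁, h₂, h₃, rfl⟩ := hc.split hw hu
    exact .join hcl hcr h₁ ((h _ _ _ hS).1 h₂) h₃
  · obtain ⟨cl, cr, S, T, a, b, c, hcl, hcr, hS, h₁, h₂, h₃, rfl⟩ := hc.split hw' hu
    exact .join hcl hcr h₁ ((h _ _ _ hS).2 h₂) h₃

/-! ### Evaluation of colorings layer by layer. -/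

theorem wordColoring_nil {S T : List C} {n : ℤ} : WordColoring g [] S T n ↔ S = T ∧ n = 0 :=
  Iff.rfl

theorem wordColoring_cup {l r o w} {S T : List C} {n : ℤ} (h : S.length = l.length + r.length) :
    WordColoring g (⟨l, cup o, r⟩ :: w) S T n ↔
      ∃ c, WordColoring g w (S.take l.length ++ c :: c :: S.drop l.length) T n := by
  constructor
  · rintro ⟨M, k, m, ⟨cl, cr, s, t, hl, hr, rfl, rfl, rfl, ⟨c, rfl⟩, rfl⟩, h, rfl⟩
    refine ⟨c, ?_⟩
    simp only [List.append_nil] at hl hr ⊢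
    rw [← hl]
    simpa using h
  · rintro ⟨c, h⟩
    refine ⟨_, 0, n, ⟨S.take l.length, S.drop l.length, [], [c, c], by simp; lia, by simp; lia,
      by simp, rfl, rfl, ⟨c, rfl⟩, rfl⟩, ?_, by simp⟩
    simpa using h

theorem wordColoring_cap {l r o w} {S T : List C} {n : ℤ}
    (h : S.length = l.length + r.length + 2) :
    WordColoring g (⟨l, cap o, r⟩ :: w) S T n ↔
      S[l.length] = S[l.length + 1] ∧
        WordColoring g w (S.take l.length ++ S.drop (l.length + 2)) T n := by
  constructor
  · rintro ⟨M, k, m, ⟨cl, cr, s, t, hl, hr, rfl, rfl, ⟨c, rfl⟩, rfl, rfl⟩, h, rfl⟩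
    simp only at hl hr
    simp only [← hl]
    simpa using h
  · rintro ⟨e, h⟩
    refine ⟨_, 0, n, ⟨S.take l.length, S.drop (l.length + 2), [S[l.length], S[l.length]], [],
      by simp; lia, by simp; lia, ?_, rfl, ⟨_, rfl⟩, rfl, rfl⟩, by simpa using h, by simp⟩
    conv_lhs => rw [← List.take_append_drop l.length S, List.drop_eq_getElem_cons (by lia),
      List.drop_eq_getElem_cons (by lia)]
    simp [e]

theorem wordColoring_cross {l r σ a b w} {S T : List C} {n : ℤ}
    (h : S.length = l.length + r.length + 2) :
    WordColoring g (⟨l, cross σ a b, r⟩ :: w) S T n ↔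
      WordColoring g w (S.take l.length ++ S[l.length + 1] :: S[l.length] ::
        S.drop (l.length + 2)) T
        (n - dirSign σ * dirSign a * dirSign b * g S[l.length] S[l.length + 1]) := by
  constructor
  · rintro ⟨M, k, m, ⟨cl, cr, s, t, hl, hr, rfl, rfl, x, y, rfl, rfl, rfl⟩, h, rfl⟩
    simp only at hl hr
    simp only [← hl]
    simpa using h
  · intro h
    refine ⟨_, dirSign σ * dirSign a * dirSign b * g S[l.length] S[l.length + 1], _,
      ⟨S.take l.length, S.drop (l.length + 2), [S[l.length], S[l.length + 1]], _,
      by simp; lia, by simp; lia, ?_, rfl, _, _, rfl, rfl, rfl⟩, by simpa using h, by ring⟩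
    conv_lhs => rw [← List.take_append_drop l.length S, List.drop_eq_getElem_cons (by lia),
      List.drop_eq_getElem_cons (by lia)]
    simp

theorem wordColoring_grid {σ a a' b b' : Bool} {x x' y y' : C} {T : List C} {n : ℤ} :
    WordColoring g (grid σ a a' b b') [x, x', y, y'] T n ↔ T = [y, y', x, x'] ∧
      n = dirSign σ * (dirSign a * dirSign b * g x y + dirSign a * dirSign b' * g x y' +
        dirSign a' * dirSign b * g x' y + dirSign a' * dirSign b' * g x' y') := by
  simp [grid, wordColoring_cross, wordColoring_nil, eq_comm (b := T)]
  intro _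
  constructor <;> intro h <;> linear_combination h

/-! ### Isotopy invariance of the weights. -/

theorem coloringEquiv_exchange (p q : Piece) (m : List Bool) :
    ColoringEquiv g [⟨[], p, m ++ q.bot⟩, ⟨p.top ++ m, q, []⟩]
      [⟨p.bot ++ m, q, []⟩, ⟨[], p, m ++ q.top⟩] := by
  refine ⟨p.bot ++ m ++ q.bot, p.top ++ m ++ q.top, ?_, ?_, fun S T n _ => ?_⟩
  · simp [IsTangle, Layer.bot, Layer.top]
  · simp [IsTangle, Layer.bot, Layer.top]
  -- A description without heights: independent colorings of `p` and `q`, with the strands `cm`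
  -- between them.
  trans ∃ s t cm s' t' k k', cm.length = m.length ∧ S = s ++ cm ++ s' ∧ T = t ++ cm ++ t' ∧
    PieceColoring g p s t k ∧ PieceColoring g q s' t' k' ∧ n = k + k'
  · constructor
    · rintro ⟨M, k, n', ⟨cl, cr, s, t, hl, hr, rfl, rfl, hp⟩,
        ⟨M', k', n'', ⟨cl', cr', s', t', hl', hr', e, rfl, hq⟩, ⟨rfl, rfl⟩, rfl⟩, rfl⟩
      obtain rfl := List.length_eq_zero_iff.1 hl
      obtain rfl := List.length_eq_zero_iff.1 hr'
      have hp' := hp.length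
      have hq' := hq.length
      simp only [List.length_append, List.append_nil, List.nil_append] at *
      have := congrArg List.length e
      simp only [List.length_append] at this
      obtain ⟨cm, rfl⟩ : ∃ cm, cl' = t ++ cm :=
        ⟨cl'.drop t.length, by
          have h₁ := congrArg (List.take t.length) e
          rw [List.take_left, List.take_append_of_le_length (by lia)] at h₁
          nth_rw 1 [h₁]
          exact (List.take_append_drop _ _).symm⟩
      simp only [List.append_assoc, List.append_cancel_left_eq, List.length_append] at e hl'
      subst e
      exact ⟨s, t, cm, s', t', k, k', by lia, by simp, by simp, hp, hq, by ring⟩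
    · rintro ⟨s, t, cm, s', t', k, k', hcm, rfl, rfl, hp, hq, rfl⟩
      exact ⟨_, k, _, ⟨[], cm ++ s', s, t, rfl, by simp [hcm, hq.length], by simp, rfl, hp⟩,
        ⟨_, k', 0, ⟨t ++ cm, [], s', t', by simp [hcm, hp.length], rfl, by simp, rfl, hq⟩,
          ⟨by simp, rfl⟩, rfl⟩, by ring⟩
  · constructor
    · rintro ⟨s, t, cm, s', t', k, k', hcm, rfl, rfl, hp, hq, rfl⟩
      exact ⟨_, k', _, ⟨s ++ cm, [], s', t', by simp [hcm, hp.length], rfl, by simp, rfl, hq⟩,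
        ⟨_, k, 0, ⟨[], cm ++ t', s, t, rfl, by simp [hcm, hq.length], by simp, rfl, hp⟩,
          ⟨by simp, rfl⟩, rfl⟩, by ring⟩
    · rintro ⟨M, k', n', ⟨cl', cr', s', t', hl', hr', rfl, rfl, hq⟩,
        ⟨M', k, n'', ⟨cl, cr, s, t, hl, hr, e, rfl, hp⟩, ⟨rfl, rfl⟩, rfl⟩, rfl⟩
      obtain rfl := List.length_eq_zero_iff.1 hl
      obtain rfl := List.length_eq_zero_iff.1 hr'
      have hp' := hp.length
      have hq' := hq.length
      simp only [List.length_append, List.append_nil, List.nil_append] at *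
      have := congrArg List.length e
      simp only [List.length_append] at this
      obtain ⟨cm, rfl⟩ : ∃ cm, cl' = s ++ cm :=
        ⟨cl'.drop s.length, by
          have h₁ := congrArg (List.take s.length) e
          rw [List.take_left, List.take_append_of_le_length (by lia)] at h₁
          nth_rw 1 [← h₁]
          exact (List.take_append_drop _ _).symm⟩
      simp only [List.append_assoc, List.append_cancel_left_eq, List.length_append] at e hl'
      subst e
      exact ⟨s, t, cm, s', t', k, k', by lia, by simp, by simp, hp, hq, by ring⟩

/-- The weights of the colorings of a tangle are invariant under isotopy. -/
theorem IsotopyMove.coloringEquiv (hsymm : ∀ x y, g x y = g y x) (hdiag : ∀ x, g x x = 0)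
    {w w' : Word} (h : IsotopyMove w w') : ColoringEquiv g w w' := by
  cases h with
  | exchange p q m => exact coloringEquiv_exchange p q m
  | zigzag s =>
    refine ⟨[s], [s], by simp [IsTangle, Layer.bot, Layer.top, Piece.bot, Piece.top],
      rfl, fun S T n hS => ?_⟩
    obtain ⟨x, rfl⟩ := List.length_eq_one_iff.1 hS
    simp [wordColoring_cup, wordColoring_cap, wordColoring_nil]
  | zigzag' s =>
    refine ⟨[s], [s], by simp [IsTangle, Layer.bot, Layer.top, Piece.bot, Piece.top],
      rfl, fun S T n hS => ?_⟩
    obtain ⟨x, rfl⟩ := List.length_eq_one_iff.1 hS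
    simp [wordColoring_cup, wordColoring_cap, wordColoring_nil]
  | swingCap σ o s =>
    refine ⟨[o, s, !o], [s], by simp [IsTangle, Layer.bot, Layer.top, Piece.bot, Piece.top],
      by simp [IsTangle, Layer.bot, Layer.top, Piece.bot, Piece.top], fun S T n hS => ?_⟩
    obtain ⟨x, y, z, rfl⟩ := List.length_eq_three.1 hS
    simp [wordColoring_cross, wordColoring_cap, wordColoring_nil]
    rintro rfl rfl
    -- Both the over/under flag and one direction are reversed, so the sign of the crossing is
    -- unchanged.
    rw [dirSign_not, dirSign_not, hsymm x y]
    ring_nf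
  | swingCup σ o s =>
    refine ⟨[s], [o, s, !o], by simp [IsTangle, Layer.bot, Layer.top, Piece.bot, Piece.top],
      by simp [IsTangle, Layer.bot, Layer.top, Piece.bot, Piece.top], fun S T n hS => ?_⟩
    obtain ⟨x, rfl⟩ := List.length_eq_one_iff.1 hS
    simp [wordColoring_cross, wordColoring_cup, wordColoring_nil]
    refine exists_congr fun c => and_congr_right fun _ => ?_
    rw [dirSign_not, dirSign_not, hsymm x c]
    ring_nf
  | reidemeister₁ σ s =>
    refine ⟨[s], [s], by simp [IsTangle, Layer.bot, Layer.top, Piece.bot, Piece.top],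
      rfl, fun S T n hS => ?_⟩
    obtain ⟨x, rfl⟩ := List.length_eq_one_iff.1 hS
    simp [wordColoring_cross, wordColoring_cup, wordColoring_cap, wordColoring_nil, hdiag]
  | reidemeister₁' σ s =>
    refine ⟨[s], [s], by simp [IsTangle, Layer.bot, Layer.top, Piece.bot, Piece.top],
      rfl, fun S T n hS => ?_⟩
    obtain ⟨x, rfl⟩ := List.length_eq_one_iff.1 hS
    simp [wordColoring_cross, wordColoring_cup, wordColoring_cap, wordColoring_nil, hdiag]
  | reidemeister₂ σ s t =>
    refine ⟨[s, t], [s, t], by simp [IsTangle, Layer.bot, Layer.top, Piece.bot, Piece.top],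
      rfl, fun S T n hS => ?_⟩
    obtain ⟨x, y, rfl⟩ := List.length_eq_two.1 hS
    simp [wordColoring_cross, wordColoring_nil]
    rintro rfl
    rw [dirSign_not, hsymm y x]
    ring_nf
  | reidemeister₃ σ τ υ a b c h =>
    refine ⟨[a, b, c], [c, b, a],
      by simp [IsTangle, Layer.bot, Layer.top, Piece.bot, Piece.top],
      by simp [IsTangle, Layer.bot, Layer.top, Piece.bot, Piece.top], fun S T n hS => ?_⟩
    obtain ⟨x, y, z, rfl⟩ := List.length_eq_three.1 hS
    simp [wordColoring_cross, wordColoring_nil]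
    rintro rfl
    ring_nf

theorem IsotopyMove.ne_nil {w w' : Word} (h : IsotopyMove w w') : w ≠ [] := by
  cases h <;> exact List.cons_ne_nil _ _

/-- The set of weights of colorings is an invariant of links. -/
def Link.weights (hsymm : ∀ x y, g x y = g y x) (hdiag : ∀ x, g x x = 0) : Link → Set ℤ :=
  Quot.lift (fun D => {n | WordColoring g D.word [] [] n}) <| by
    rintro D D' ⟨u, v, w, w', l, r, h, e, e'⟩
    ext n
    have hD := D.closed
    rw [e] at hD
    change WordColoring g D.word [] [] n ↔ WordColoring g D'.word [] [] n
    rw [e, e']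
    exact (h.coloringEquiv hsymm hdiag).closed_iff h.ne_nil hD n

theorem wordColoring_circles (os : List Bool) {n : ℤ}
    (h : WordColoring g (circles os) [] [] n) : n = 0 := by
  induction os with
  | nil => exact h.2
  | cons o os ih =>
    simp only [circles, List.flatMap_cons, List.cons_append, List.nil_append] at h
    simp [wordColoring_cup, wordColoring_cap] at h
    exact ih h.2

theorem IsUnlink.eq_zero {hsymm : ∀ x y, g x y = g y x} {hdiag : ∀ x, g x x = 0} {L : Link}
    (h : IsUnlink L) {n : ℤ} (hn : n ∈ L.weights hsymm hdiag) : n = 0 := by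
  obtain ⟨D, os, hD, rfl⟩ := h
  replace hn : WordColoring g D.word [] [] n := hn
  exact wordColoring_circles os (hD ▸ hn)

/-! ### Lower bounds: changing the crossings of a grid. -/

theorem isTangle_grid (σ a a' b b' : Bool) : IsTangle (grid σ a a' b b') [a, a', b, b']
    [b, b', a, a'] := by
  simp [grid, IsTangle, Layer.bot, Layer.top, Piece.bot, Piece.top]

/-- A link that becomes an unlink after the change of all crossings of a grid: its weights come
from the grid. -/
theorem weight_eq_of_grid {hsymm : ∀ x y, g x y = g y x} {hdiag : ∀ x, g x x = 0}
    {D D' : LinkDiagram} {u v : Word} {l r : List Bool} {σ a a' b b' : Bool}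
    (hD : D.word = u ++ pad l r (grid σ a a' b b') ++ v)
    (hD' : D'.word = u ++ pad l r (grid (!σ) a a' b b') ++ v) (h : IsUnlink D'.link)
    {n : ℤ} (hn : n ∈ D.link.weights hsymm hdiag) :
    ∃ x x' y y', n = 2 * (dirSign σ * (dirSign a * dirSign b * g x y +
      dirSign a * dirSign b' * g x y' + dirSign a' * dirSign b * g x' y +
      dirSign a' * dirSign b' * g x' y')) := by
  have hc : IsTangle (u ++ pad l r (grid σ a a' b b') ++ v) [] [] := hD ▸ D.closed
  replace hn : WordColoring g D.word [] [] n := hn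
  rw [hD] at hn
  obtain ⟨cl, cr, S, T, i, j, k, hcl, hcr, hS, h₁, h₂, h₃, rfl⟩ := hn.split
    (isTangle_grid σ a a' b b') (isTangle_below (isTangle_grid σ a a' b b') (by simp [grid]) hc)
  obtain ⟨x, x', y, y', rfl⟩ : ∃ x x' y y', S = [x, x', y, y'] := by
    match S, hS with
    | [x, x', y, y'], _ => exact ⟨x, x', y, y', rfl⟩
  obtain ⟨rfl, rfl⟩ := wordColoring_grid.1 h₂
  have h' := WordColoring.join hcl hcr h₁
    ((wordColoring_grid (σ := !σ) (a := a) (a' := a') (b := b) (b' := b')).2 ⟨rfl, rfl⟩) h₃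
  have h0 := h.eq_zero (hsymm := hsymm) (hdiag := hdiag) (hD' ▸ h' : WordColoring g D'.word [] [] _)
  refine ⟨x, x', y, y', ?_⟩
  rw [dirSign_not] at h0
  -- The weights before and after are `i + j + k` and `i - j + k = 0`, so the first is `2 * j`.
  linear_combination h0

end Coloring

/-- A weight for linking numbers, with values that distinguish the linking numbers of four
components. -/
def fourthPower (x y : Fin 4) : ℤ := ((x : ℤ) - y) ^ 4

theorem fourthPower_comm (x y : Fin 4) : fourthPower x y = fourthPower y x := by
  unfold fourthPower; ring

theorem fourthPower_self (x : Fin 4) : fourthPower x x = 0 := by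
  simp [fourthPower]

theorem fourthPower_mem_weights_hopfCable :
    100 ∈ hopfCable.weights fourthPower_comm fourthPower_self := by
  change WordColoring fourthPower (cableWord hopf.word) [] [] 100
  simp only [cableWord, hopf, List.flatMap_cons, List.flatMap_nil, cablePiece, cableLevel, pad,
    grid, List.map_cons, List.map_nil, List.nil_append, List.cons_append]
  simp [wordColoring_cup, wordColoring_cap, wordColoring_cross, wordColoring_nil, dirSign]
  -- Distinct colors for the four circles, in the order of their minima. Each of the two grids
  -- contributes `81 + 1 - 16 - 16 = 50`.
  refine ⟨0, 1, 2, 3, ?_⟩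
  decide

theorem not_isUnlink_hopfCable : ¬ IsUnlink hopfCable := fun h =>
  absurd (h.eq_zero fourthPower_mem_weights_hopfCable) (by norm_num)

/-- With the values 0, 1, 16, 81 the only way to 50 is `81 + 1 - 16 - 16`. Then `x`, `x'` have
distances 3 and 1 from `y`, so they are 3 and 1 or 0 and 2, and no `y'` has distance 2 from both.
For -50 exchange `y` and `y'`. -/
theorem fourthPower_grid_ne (x x' y y' : Fin 4) :
    fourthPower x y - fourthPower x y' + fourthPower x' y - fourthPower x' y' ≠ 50 ∧
    fourthPower x y - fourthPower x y' + fourthPower x' y - fourthPower x' y' ≠ -50 := by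
  revert x x' y y'
  decide

theorem not_isUnlink_of_oneTwoPicture {L : Link} (h : MoveBetween OneTwoPicture hopfCable L) :
    ¬ IsUnlink L := by
  intro hL
  obtain ⟨D, D', hD, rfl, u, v, w, w', l, r, hw, e, e'⟩ := h
  have hn := fourthPower_mem_weights_hopfCable
  rw [← hD] at hn
  cases hw with
  | parallelLeft σ a b =>
    obtain ⟨x, x', y, y', h⟩ := weight_eq_of_grid e e' hL hn
    obtain ⟨h₁, h₂⟩ := fourthPower_grid_ne x x' y y'
    cases σ <;> cases a <;> cases b <;> simp [dirSign] at h <;> lia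
  | parallelRight σ a b =>
    -- Here `y`, `y'` are the parallel strands, so the two pairs change roles.
    obtain ⟨x, x', y, y', h⟩ := weight_eq_of_grid e e' hL hn
    obtain ⟨h₁, h₂⟩ := fourthPower_grid_ne y y' x x'
    simp only [fourthPower_comm x, fourthPower_comm x'] at h
    cases σ <;> cases a <;> cases b <;> simp [dirSign] at h <;> lia

/-! ### Explicit isotopies -/

deriving instance DecidableEq for Piece
deriving instance DecidableEq for Layer

instance decidableIsTangle : (w : Word) → (s t : List Bool) → Decidable (IsTangle w s t)
  | [], s, t => inferInstanceAs (Decidable (s = t))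
  | x :: w, _, t =>
    have := decidableIsTangle w x.top t
    inferInstanceAs (Decidable (_ ∧ _))

/-- The instruction to replace the subdiagram `old`, which begins at the given height and with
the strand at the given column, by the isotopic subdiagram `new`. -/
structure Step where
  height : ℕ
  column : ℕ
  old : Word
  new : Word
  isotopyMove : IsotopyMove old new ∨ IsotopyMove new old

namespace Step

/-- The number of strands at the bottom of the replaced subdiagram. -/
def width (x : Step) : ℕ :=
  -- One side of a move may be empty; the first layer of the concatenation then comes from the other
  -- side, which has the same bottom.
  ((x.old ++ x.new).head?.elim [] Layer.bot).length

/-- Carry out a step, if it is possible. -/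
def run (x : Step) (w : Word) : Option Word :=
  let level := (w.drop x.height).head?.elim [] Layer.bot
  let l := level.take x.column
  let r := level.drop (x.column + x.width)
  let u := w.take x.height
  let v := w.drop (x.height + x.old.length)
  if w = u ++ pad l r x.old ++ v ∧ IsTangle (u ++ pad l r x.new ++ v) [] [] then
    some (u ++ pad l r x.new ++ v)
  else none

/-- `run` itself checks that the old subdiagram is present and that the result is closed, so the
choice of heights and columns needs no proof. -/
theorem link_eq {x : Step} {w w' : Word} (h : x.run w = some w') (hw : IsTangle w [] []) :
    ∃ hw' : IsTangle w' [] [], LinkDiagram.link ⟨w, hw⟩ = LinkDiagram.link ⟨w', hw'⟩ := by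
  simp only [run, Option.ite_none_right_eq_some, Option.some.injEq] at h
  obtain ⟨⟨h₁, h₂⟩, rfl⟩ := h
  refine ⟨h₂, ?_⟩
  rcases x.isotopyMove with hm | hm
  · exact Quot.sound ⟨_, _, _, _, _, _, hm, h₁, rfl⟩
  · exact (Quot.sound ⟨_, _, _, _, _, _, hm, rfl, h₁⟩).symm

/-- Exchange the layer at height `i` and the layer above it. -/
def exchange (i : ℕ) (w : Word) : Step :=
  match w.drop i with
  | x :: y :: _ =>
    if x.left.length + x.piece.top.length ≤ y.left.length then
      ⟨i, x.left.length, _, _, .inl (.exchange x.piece y.piece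
        (y.left.drop (x.left.length + x.piece.top.length)))⟩
    else
      ⟨i, y.left.length, _, _, .inr (.exchange y.piece x.piece
        (x.left.drop (y.left.length + y.piece.bot.length)))⟩
  -- An arbitrary default for fewer than two layers.
  | _ => ⟨i, 0, _, _, .inl (.zigzag true)⟩

/-- Move the layer at height `i + k` down to height `i`. -/
def descend (i k : ℕ) : List (Word → Step) :=
  (List.range k).reverse.map fun j => exchange (i + j)

/-- Replace the left side of an isotopy move by the right side. -/
def forward {a b : Word} (i k : ℕ) (h : IsotopyMove a b) (_ : Word) : Step :=
  ⟨i, k, a, b, .inl h⟩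

/-- Replace the right side of an isotopy move by the left side. -/
def backward {a b : Word} (i k : ℕ) (h : IsotopyMove a b) (_ : Word) : Step :=
  ⟨i, k, b, a, .inr h⟩

/-- Carry out a list of steps, each of which may depend on the diagram. -/
def runAll : List (Word → Step) → Word → Option Word
  | [], w => some w
  | x :: xs, w => ((x w).run w).bind (runAll xs)

theorem link_eq_of_runAll {xs : List (Word → Step)} {w w' : Word} (h : runAll xs w = some w')
    (hw : IsTangle w [] []) (hw' : IsTangle w' [] []) :
    LinkDiagram.link ⟨w, hw⟩ = LinkDiagram.link ⟨w', hw'⟩ := by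
  induction xs generalizing w with
  | nil => cases h; rfl
  | cons x xs ih =>
    obtain ⟨w₁, h₁, h₂⟩ := Option.bind_eq_some_iff.1 h
    obtain ⟨hw₁, e⟩ := link_eq h₁ hw
    exact e.trans (ih h₂ hw₁)

/-- A small circle, which starts at height `i` and column `k` and whose left end has direction
`o`, moves over the strand of direction `s` to its right. -/
def circleOver (i k : ℕ) (o s : Bool) : List (Word → Step) :=
  [backward (i + 1) (k + 1) (.reidemeister₂ true (!o) s), backward i k (.swingCup false o s),
    backward (i + 2) k (.swingCap true o s), forward (i + 1) k (.reidemeister₂ false s o)]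

/-- A minimum, at height `i`, moves to the left across the strand of direction `s` at
column `k`. -/
def cupAcross (i k : ℕ) (σ o s : Bool) : List (Word → Step) :=
  [backward (i + 1) k (.reidemeister₂ (!σ) s o), forward i k (.swingCup (!σ) o s)]

end Step

open Step

/-! ### Upper bounds: the two annuli and the detour. -/

/-- The two circles of the Hopf diagram are doubled to annuli, and the crossings at the second
place where the annuli meet are given by `σ`. -/
def annuli (σ : Bool) : LinkDiagram where
  word :=
    cableWord [⟨[], cup true, []⟩, ⟨[true, false], cup true, []⟩,
      ⟨[true], cross true false true, [false]⟩] ++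
    pad [true, false] [true, false] (grid σ true false true false) ++
    cableWord [⟨[true, false], cap true, []⟩, ⟨[], cap true, []⟩]
  closed := by cases σ <;> decide

theorem link_annuli_true : (annuli true).link = hopfCable := rfl

/-- Separate the annuli, one of which lies above the other, and put the four circles on top of
each other. -/
theorem isUnlink_annuli_false : IsUnlink (annuli false).link := by
  refine ⟨⟨circles [true, false, true, false], by decide⟩, _, rfl, (link_eq_of_runAll
    -- The two grids now cancel in four second Reidemeister moves; then the inner circle of each
    -- annulus leaves the outer one.
    (xs := [forward 7 3 (.reidemeister₂ true true false), exchange 6,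
      forward 5 2 (.reidemeister₂ true true true), forward 5 4 (.reidemeister₂ true false false),
      forward 4 3 (.reidemeister₂ true false true)] ++ circleOver 3 5 false false ++
      descend 3 2 ++ descend 2 4 ++ circleOver 1 1 false false ++ descend 1 6) ?_ _ _).symm⟩
  rfl

/-- One of the strands of an annulus makes a detour, so that the other annulus is crossed by two
strands that go up and by two strands that go down. -/
def detour (σ ρ : Bool) : LinkDiagram where
  word :=
    cableWord [⟨[], cup true, []⟩, ⟨[true, false], cup true, []⟩,
      ⟨[true], cross true false true, [false]⟩] ++
    [⟨[true, false, true], cup false, [false, true, false, true, false]⟩,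
      ⟨[true, false, true], cross true false true, [false, true, false, true, false]⟩] ++
    pad [true, false, true, true] [true, false] (grid ρ false false true false) ++
    pad [true, false] [false, false, true, false] (grid σ true true true false) ++
    [⟨[true, false, true, false, true], cross false true false, [false, true, false]⟩,
      ⟨[true, false, true, false, true, false], cap true, [true, false]⟩] ++
    cableWord [⟨[true, false], cap true, []⟩, ⟨[], cap true, []⟩]
  closed := by cases σ <;> cases ρ <;> decide

theorem link_annuli_eq_link_detour (σ : Bool) : (annuli σ).link = (detour σ σ).link := by
  refine link_eq_of_runAll
    -- Fold the downward strand, let the fold cross itself twice, and pull its minimum across the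
    -- other annulus. The third Reidemeister moves then take the lower self-crossing past that
    -- annulus; they are allowed for either `σ`, since each of its strands is over both strands of
    -- the fold or under both.
    (xs := [backward 12 5 (.zigzag' false), backward 13 5 (.reidemeister₂ true false true),
      exchange 11] ++ cupAcross 11 4 σ false false ++ [exchange 10, exchange 9] ++
      cupAcross 9 3 σ false true ++ [exchange 8, exchange 16,
      backward 14 4 (.reidemeister₃ true σ σ false true false (.inr rfl)), exchange 13,
      exchange 12, backward 10 3 (.reidemeister₃ true σ σ false true true (.inr rfl)),
      exchange 9] ++ descend 12 2 ++ descend 13 2) ?_ _ _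
  cases σ <;> rfl

theorem moveBetween_annuli : MoveBetween PassPicture (annuli true).link (annuli false).link :=
  ⟨_, _, rfl, rfl, _, _, _, _, _, _, .mk true true true, rfl, rfl⟩

theorem moveBetween_detour_left (ρ : Bool) :
    MoveBetween OneTwoPicture (detour true ρ).link (detour false ρ).link :=
  -- Layers 14 to 17, counted from 0, are the upper grid; the lower one occupies 10 to 13.
  ⟨_, _, rfl, rfl, (detour true ρ).word.take 14, (detour true ρ).word.drop 18, _, _,
    [true, false], [false, false, true, false], .parallelLeft true true true, rfl, rfl⟩

theorem moveBetween_detour_right :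
    MoveBetween OneTwoPicture (detour false true).link (detour false false).link :=
  ⟨_, _, rfl, rfl, (detour false true).word.take 10, (detour false true).word.drop 14, _, _,
    [true, false, true, true], [true, false], .parallelLeft true false true, rfl, rfl⟩

theorem moveNumber_le {P : Word → Word → Prop} {L : Link} {n : ℕ} (h : UnlinksIn P n L) :
    moveNumber P L ≤ n :=
  iInf₂_le n h

theorem le_moveNumber {P : Word → Word → Prop} {L : Link} {n : ℕ}
    (h : ∀ m < n, ¬ UnlinksIn P m L) : n ≤ moveNumber P L :=
  le_iInf₂ fun m hm => by
    by_contra hlt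
    exact h m (by exact_mod_cast not_le.1 hlt) hm

end OneTwoPass

theorem theorem5p1 :
    OneTwoPass.passNumber OneTwoPass.hopfCable = 1 ∧
      OneTwoPass.oneTwoNumber OneTwoPass.hopfCable = 2 := by
  open OneTwoPass in
  constructor
  · refine le_antisymm (moveNumber_le (n := 1) ?_) (le_moveNumber (n := 1) fun m hm => ?_)
    · exact ⟨_, moveBetween_annuli, isUnlink_annuli_false⟩
    · obtain rfl : m = 0 := by lia
      exact not_isUnlink_hopfCable
  · refine le_antisymm (moveNumber_le (n := 2) ?_) (le_moveNumber (n := 2) fun m hm => ?_)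
    · refine ⟨_, ?_, _, moveBetween_detour_right, ?_⟩
      · rw [← link_annuli_true, link_annuli_eq_link_detour]
        exact moveBetween_detour_left true
      · change IsUnlink _
        rw [← link_annuli_eq_link_detour]
        exact isUnlink_annuli_false
    · interval_cases m
      · exact not_isUnlink_hopfCable
      · rintro ⟨L, hL, h⟩
        exact not_isUnlink_of_oneTwoPicture hL h
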